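/- Let $\Omega$ be a compact topological space with a $\sigma$-algebra $\mathcal A$ containing the open sets (for instance a compact Radon measure space), let $X$ be a real Banach space, let $cb(X)$ be the family of nonempty, closed, bounded, convex subsets of $X$, and let $d_H$ be the Hausdorff distance. Measures are finite non-negative measures on $\mathcal A$. A *gauge* is a map $\Delta$ assigning to every $t\in\Omega$ an open set $\Delta(t)\ni t$. A *partition* is a finite family $\{(A_i,t_i)\}_{i\le p}$ where the $A_i\in\mathcal A$ are disjoint with union $\Omega$ and $t_i\in\Omega$; it is *subordinated* to $\Delta$ if $A_i\subset\Delta(t_i)$ for all $i$. A multifunction $\Gamma:\Omega\to cb(X)$ is *$m$-McShane integrable* with integral $(MS)\int_\Omega\Gamma\,dm=I\in cb(X)$ if for every $\varepsilon>0$ there is a gauge $\Delta$ such that $d_H\bigl(I,\sum_{i\le p}\Gamma(t_i)\,m(A_i)\bigr)<\varepsilon$ for every partition subordinated to $\Delta$ (the sum being a Minkowski sum). For $A\in\mathcal A$, *$m$-McShane integrability of $\Gamma$ on $A$* and $(MS)\int_A\Gamma\,dm$ mean integrability and the integral over $\Omega$ with respect to the measure $E\mapsto m(E\cap A)$, so that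 the relevant sums are $\sum_i\Gamma(t_i)\,m(A_i\cap A)$. For a sequence $(m_n)_n$ of measures, a sequence $(\Gamma_n)_n$ of $m_n$-McShane integrable multifunctions is *$(m_n)$-equi-integrable* if for every $\varepsilon>0$ there is a gauge $\Delta$ such that, for every $n$ and every partition subordinated to $\Delta$, $d_H\bigl(\sum_i\Gamma_n(t_i)\,m_n(A_i),(MS)\int_\Omega\Gamma_n\,dm_n\bigr)<\varepsilon$. **Theorem 3.13.** Let $m$ and $(m_n)_n$ be measures, let $\Gamma_n:\Omega\to cb(X)$ be $m_n$-McShane integrable for every $n\in\mathbb N$, and let $\Gamma:\Omega\to cb(X)$. Suppose that (i) $(\Gamma_n)_n$ is $(m_n)$-equi-integrable on $\Omega$; (ii) $\lim_{n\to\infty}d_H(\Gamma_n(t),\Gamma(t))=0$ for every $t\in\Omega$; (iii) $(m_n)_n$ converges setwise to $m$, that is, $m_n(A)\to m(A)$ for every $A\in\mathcal A$. Then $\Gamma$ is $m$-McShane integrable on $\Omega$ and, for every $A\in\mathcal A$, all the $\Gamma_n$ are $m_n$-McShane integrable on $A$, $\Gamma$ is $m$-McShane integrable on $A$, and $$\lim_{n\to\infty}d_H\Bigl((MS)\int_A\Gamma_n\,dm_n,\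 (MS)\int_A\Gamma\,dm\Bigr)=0 .$$ Moreover, if (iii) is replaced by convergence in total variation, $|m_n-m|(\Omega)\to0$, then the same conclusions hold and the last limit is uniform in $A\in\mathcal A$. -/

import Mathlib

open MeasureTheory Filter Topology
open scoped Pointwise

noncomputable section

namespace McShane

/-- `cb(X)`: the nonempty, closed, bounded, convex subsets of a real normed space `X`. -/
structure ClosedBoundedConvex (X : Type*) [NormedAddCommGroup X] [NormedSpace ℝ X] where
  carrier : Set X
  nonempty' : carrier.Nonempty
  isClosed' : IsClosed carrier
  isBounded' : Bornology.IsBounded carrier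
  convex' : Convex ℝ carrier

instance {X : Type*} [NormedAddCommGroup X] [NormedSpace ℝ X] :
    CoeOut (ClosedBoundedConvex X) (Set X) :=
  ⟨ClosedBoundedConvex.carrier⟩

instance {X : Type*} [NormedAddCommGroup X] [NormedSpace ℝ X] :
    Inhabited (ClosedBoundedConvex X) :=
  ⟨⟨{0}, Set.singleton_nonempty 0, isClosed_singleton, Bornology.isBounded_singleton,
    convex_singleton 0⟩⟩

/-- A gauge on `Ω`: a choice of an open neighbourhood `Δ t ∋ t` of every point `t`. -/
structure Gauge (Ω : Type*) [TopologicalSpace Ω] where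
  toFun : Ω → Set Ω
  isOpen' : ∀ t, IsOpen (toFun t)
  mem' : ∀ t, t ∈ toFun t

/-- A finite strict generalized McShane partition of `Ω`: a finite disjoint cover of `Ω` by
measurable sets `part i`, each with a tag `tag i ∈ Ω` (which need not belong to `part i`). -/
structure Partition (Ω : Type*) [MeasurableSpace Ω] where
  size : ℕ
  part : Fin size → Set Ω
  tag : Fin size → Ω
  measurable' : ∀ i, MeasurableSet (part i)
  disjoint' : Pairwise fun i j => Disjoint (part i) (part j)
  cover' : ⋃ i, part i = Set.univ

/-- The partition `P` is subordinated to the gauge `Δ`. -/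
def Partition.Subordinate {Ω : Type*} [TopologicalSpace Ω] [MeasurableSpace Ω]
    (P : Partition Ω) (Δ : Gauge Ω) : Prop :=
  ∀ i, P.part i ⊆ Δ.toFun (P.tag i)

/-- The McShane sum `∑ i, m (A i) • Γ (t i)` (Minkowski sum and dilation of sets). -/
def mcShaneSum {Ω X : Type*} [MeasurableSpace Ω] [NormedAddCommGroup X] [NormedSpace ℝ X]
    (Γ : Ω → ClosedBoundedConvex X) (m : Measure Ω) (P : Partition Ω) : Set X :=
  ∑ i, m.real (P.part i) • (Γ (P.tag i) : Set X)

/-- `I ∈ cb(X)` is a McShane integral over `Ω` of the multifunction `Γ` with respect to `m`. -/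
def HasMcShaneIntegral {Ω X : Type*} [TopologicalSpace Ω] [MeasurableSpace Ω]
    [NormedAddCommGroup X] [NormedSpace ℝ X]
    (Γ : Ω → ClosedBoundedConvex X) (m : Measure Ω) (I : ClosedBoundedConvex X) : Prop :=
  ∀ ε : ℝ, 0 < ε → ∃ Δ : Gauge Ω, ∀ P : Partition Ω, P.Subordinate Δ →
    Metric.hausdorffDist (I : Set X) (mcShaneSum Γ m P) < ε

/-- `Γ` is `m`-McShane integrable on `Ω`. -/
def McShaneIntegrable {Ω X : Type*} [TopologicalSpace Ω] [MeasurableSpace Ω]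
    [NormedAddCommGroup X] [NormedSpace ℝ X]
    (Γ : Ω → ClosedBoundedConvex X) (m : Measure Ω) : Prop :=
  ∃ I : ClosedBoundedConvex X, HasMcShaneIntegral Γ m I

open Classical in
/-- The McShane integral over `Ω` of `Γ` with respect to `m`
(the junk value `{0}` when `Γ` is not integrable). -/
def mcShaneIntegral {Ω X : Type*} [TopologicalSpace Ω] [MeasurableSpace Ω]
    [NormedAddCommGroup X] [NormedSpace ℝ X]
    (Γ : Ω → ClosedBoundedConvex X) (m : Measure Ω) : ClosedBoundedConvex X :=
  if h : McShaneIntegrable Γ m then h.choose else default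

/-- `Γ` is `m`-McShane integrable on the set `A`: it is integrable with respect to the measure
`E ↦ m (E ∩ A)`, that is, the sums `∑ i, m (A i ∩ A) • Γ (t i)` converge. -/
def McShaneIntegrableOn {Ω X : Type*} [TopologicalSpace Ω] [MeasurableSpace Ω]
    [NormedAddCommGroup X] [NormedSpace ℝ X]
    (Γ : Ω → ClosedBoundedConvex X) (A : Set Ω) (m : Measure Ω) : Prop :=
  McShaneIntegrable Γ (m.restrict A)

/-- The McShane integral of `Γ` over the set `A` with respect to `m`. -/
def mcShaneIntegralOn {Ω X : Type*} [TopologicalSpace Ω] [MeasurableSpace Ω]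
    [NormedAddCommGroup X] [NormedSpace ℝ X]
    (Γ : Ω → ClosedBoundedConvex X) (A : Set Ω) (m : Measure Ω) : ClosedBoundedConvex X :=
  mcShaneIntegral Γ (m.restrict A)

/-- A sequence `Γ n` of `m n`-McShane integrable multifunctions is `(m n)`-equi-integrable: for
every `ε` one gauge serves all the indices `n`. -/
def EquiIntegrable {Ω X : Type*} [TopologicalSpace Ω] [MeasurableSpace Ω]
    [NormedAddCommGroup X] [NormedSpace ℝ X]
    (Γ : ℕ → Ω → ClosedBoundedConvex X) (m : ℕ → Measure Ω) : Prop :=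
  (∀ n, McShaneIntegrable (Γ n) (m n)) ∧
  ∀ ε : ℝ, 0 < ε → ∃ Δ : Gauge Ω, ∀ n, ∀ P : Partition Ω, P.Subordinate Δ →
    Metric.hausdorffDist (mcShaneSum (Γ n) (m n) P) (mcShaneIntegral (Γ n) (m n) : Set X) < ε

/-- Setwise convergence of finite measures. -/
def SetwiseTendsto {Ω : Type*} [MeasurableSpace Ω] (ms : ℕ → Measure Ω) (m : Measure Ω) : Prop :=
  ∀ A : Set Ω, MeasurableSet A → Tendsto (fun n => (ms n).real A) atTop (𝓝 (m.real A))

/-- Convergence in total variation of finite measures: `|m - m n|(Ω) → 0`. -/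
def TotalVariationTendsto {Ω : Type*} [MeasurableSpace Ω] (ms : ℕ → Measure Ω) (m : Measure Ω)
    [∀ n, IsFiniteMeasure (ms n)] [IsFiniteMeasure m] : Prop :=
  Tendsto (fun n =>
    (m.toSignedMeasure - (ms n).toSignedMeasure).totalVariation Set.univ) atTop (𝓝 0)

end McShane

end

/-!
Let `P` and `Q` be partitions subordinated to a gauge. Gluing each of them, on `A`, to the same
subordinated partition on `Aᶜ` adds one common Minkowski summand to the sums of `P` and `Q` over
`A`, and by Rådström's cancellation law this summand does not change Hausdorff distances. Hence the
gauge of equi-integrability on `Ω` makes the sums over `A` uniformly Cauchy, simultaneously in `n`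
and in the measurable set `A`. Since `cb(X)` is complete, the integrals over `A` exist and are
limits of the sums, uniformly in `n` and `A`. For a fixed partition the sums of `Γ_n` with respect
to `m_n` converge to those of `Γ` with respect to `m`, so the theorem is an interchange of limits;
it is uniform in `A` as soon as the convergence of measures is.
-/

namespace McShane

open Metric
open scoped ENNReal

section HausdorffEDist

variable {E : Type*} [SeminormedAddCommGroup E]

lemma infEDist_add_add_le (a c : E) (B D : Set E) :
    infEDist (a + c) (B + D) ≤ infEDist a B + infEDist c D :=
  ENNReal.le_iInf₂_add_iInf₂ fun b hb d hd =>
    (infEDist_le_edist_of_mem (Set.add_mem_add hb hd)).trans (edist_add_add_le a c b d)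

lemma hausdorffEDist_add_add_le (A B C D : Set E) :
    hausdorffEDist (A + C) (B + D) ≤ hausdorffEDist A B + hausdorffEDist C D := by
  refine hausdorffEDist_le_of_infEDist (Set.add_subset_iff.2 fun a ha c hc => ?_)
    (Set.add_subset_iff.2 fun b hb d hd => ?_)
  · exact (infEDist_add_add_le a c B D).trans
      (add_le_add (infEDist_le_hausdorffEDist_of_mem ha) (infEDist_le_hausdorffEDist_of_mem hc))
  · rw [hausdorffEDist_comm (s := A), hausdorffEDist_comm (s := C)]
    exact (infEDist_add_add_le b d A C).trans
      (add_le_add (infEDist_le_hausdorffEDist_of_mem hb) (infEDist_le_hausdorffEDist_of_mem hd))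

lemma hausdorffEDist_add_self_le (A C : Set E) : hausdorffEDist (A + C) A ≤ hausdorffEDist C 0 := by
  simpa using hausdorffEDist_add_add_le A A C 0

lemma hausdorffEDist_finsetSum_le {ι : Type*} (s : Finset ι) (A B : ι → Set E) :
    hausdorffEDist (∑ i ∈ s, A i) (∑ i ∈ s, B i) ≤ ∑ i ∈ s, hausdorffEDist (A i) (B i) := by
  induction s using Finset.cons_induction with
  | empty => simp
  | cons i s hi ih =>
    simp only [Finset.sum_cons]
    exact (hausdorffEDist_add_add_le _ _ _ _).trans (add_le_add_right ih _)

lemma enorm_le_hausdorffEDist_zero {A : Set E} {a : E} (ha : a ∈ A) :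
    ‖a‖ₑ ≤ hausdorffEDist A 0 := by
  simpa only [← Set.singleton_zero, infEDist_singleton, edist_zero_right] using
    infEDist_le_hausdorffEDist_of_mem (t := 0) ha

lemma hausdorffEDist_zero_ne_top {A : Set E} (hA : A.Nonempty) (hb : Bornology.IsBounded A) :
    hausdorffEDist A 0 ≠ ∞ :=
  hausdorffEDist_ne_top_of_nonempty_of_bounded hA Set.zero_nonempty hb Bornology.isBounded_singleton

variable [NormedSpace ℝ E]

lemma hausdorffEDist_smul_le {A B : Set E} (hA : A.Nonempty) (hB : B.Nonempty) (r : ℝ) :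
    hausdorffEDist (r • A) (r • B) ≤ ‖r‖ₑ * hausdorffEDist A B := by
  obtain rfl | hr := eq_or_ne r 0
  · simp only [Set.zero_smul_set hA, Set.zero_smul_set hB, hausdorffEDist_self, zero_le]
  have infEDist_smul_le {A B : Set E} : ∀ x ∈ r • A, infEDist x (r • B) ≤
      ‖r‖ₑ * hausdorffEDist A B := by
    rintro _ ⟨a, ha, rfl⟩
    change infEDist (r • a) (r • B) ≤ _
    rw [infEDist_smul₀ hr, ENNReal.smul_def, smul_eq_mul]
    exact mul_le_mul_right (infEDist_le_hausdorffEDist_of_mem ha) _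
  exact hausdorffEDist_le_of_infEDist infEDist_smul_le
    (hausdorffEDist_comm (s := A) ▸ infEDist_smul_le)

lemma hausdorffEDist_smul_smul_self_le (r s : ℝ) (B : Set E) :
    hausdorffEDist (r • B) (s • B) ≤ ‖r - s‖ₑ * hausdorffEDist B 0 := by
  have edist_smul_smul_le (b : E) (hb : b ∈ B) :
      edist (r • b) (s • b) ≤ ‖r - s‖ₑ * hausdorffEDist B 0 := by
    rw [edist_eq_enorm_sub, ← sub_smul, enorm_smul]
    exact mul_le_mul_right (enorm_le_hausdorffEDist_zero hb) _
  refine hausdorffEDist_le_of_mem_edist ?_ ?_ <;> rintro _ ⟨b, hb, rfl⟩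
  · exact ⟨s • b, Set.smul_mem_smul_set hb, edist_smul_smul_le b hb⟩
  · exact ⟨r • b, Set.smul_mem_smul_set hb, edist_comm (r • b) _ ▸ edist_smul_smul_le b hb⟩

lemma hausdorffEDist_smul_smul_le {A B : Set E} (hA : A.Nonempty) (hB : B.Nonempty) (r s : ℝ) :
    hausdorffEDist (r • A) (s • B) ≤
      ‖r‖ₑ * hausdorffEDist A B + ‖r - s‖ₑ * hausdorffEDist B 0 :=
  (hausdorffEDist_triangle (t := r • B)).trans
    (add_le_add (hausdorffEDist_smul_le hA hB r) (hausdorffEDist_smul_smul_self_le r s B))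

/-- One copy of `A` is exchanged for one of `B` at a time; the single summand `C` serves every
exchange. -/
lemma hausdorffEDist_natCast_smul_add_le {A B : Set E} (hA : Convex ℝ A) (hB : Convex ℝ B)
    (hAne : A.Nonempty) (hBne : B.Nonempty) (C : Set E) (n : ℕ) :
    hausdorffEDist ((n : ℝ) • A + C) ((n : ℝ) • B + C) ≤ n * hausdorffEDist (A + C) (B + C) := by
  induction n with
  | zero => simp [Set.zero_smul_set hAne, Set.zero_smul_set hBne]
  | succ n ih =>
    have succ_smul {D : Set E} (hD : Convex ℝ D) : ((n + 1 : ℕ) : ℝ) • D = (n : ℝ) • D + D := by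
      rw [Nat.cast_succ, hD.add_smul n.cast_nonneg zero_le_one, one_smul]
    calc hausdorffEDist (((n + 1 : ℕ) : ℝ) • A + C) (((n + 1 : ℕ) : ℝ) • B + C)
        = hausdorffEDist ((n : ℝ) • A + (A + C)) ((n : ℝ) • B + C + B) := by
          rw [succ_smul hA, succ_smul hB, add_assoc, add_right_comm]
      _ ≤ hausdorffEDist ((n : ℝ) • A + (A + C)) ((n : ℝ) • A + (B + C)) +
          hausdorffEDist ((n : ℝ) • A + C + B) ((n : ℝ) • B + C + B) := by
          rw [add_assoc ((n : ℝ) • A) C B, add_comm C B]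
          exact hausdorffEDist_triangle
      _ ≤ hausdorffEDist (A + C) (B + C) + n * hausdorffEDist (A + C) (B + C) := by
          refine add_le_add ?_ ?_
          · simpa using hausdorffEDist_add_add_le ((n : ℝ) • A) ((n : ℝ) • A) (A + C) (B + C)
          · exact (by simpa using hausdorffEDist_add_add_le _ _ B B : _ ≤ _).trans ih
      _ = (n + 1 : ℕ) * hausdorffEDist (A + C) (B + C) := by push_cast; ring

lemma hausdorffEDist_natCast_smul_le {A B : Set E} (hA : Convex ℝ A) (hB : Convex ℝ B)
    (hAne : A.Nonempty) (hBne : B.Nonempty) (C : Set E) (n : ℕ) :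
    hausdorffEDist ((n : ℝ) • A) ((n : ℝ) • B) ≤
      n * hausdorffEDist (A + C) (B + C) + 2 * hausdorffEDist C 0 :=
  calc hausdorffEDist ((n : ℝ) • A) ((n : ℝ) • B)
      ≤ hausdorffEDist ((n : ℝ) • A) ((n : ℝ) • A + C) +
          (hausdorffEDist ((n : ℝ) • A + C) ((n : ℝ) • B + C) +
            hausdorffEDist ((n : ℝ) • B + C) ((n : ℝ) • B)) :=
        hausdorffEDist_triangle.trans (add_le_add_right hausdorffEDist_triangle _)
    _ ≤ hausdorffEDist C 0 +
          (n * hausdorffEDist (A + C) (B + C) + hausdorffEDist C 0) := by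
        rw [hausdorffEDist_comm (s := (n : ℝ) • A)]
        exact add_le_add (hausdorffEDist_add_self_le _ C)
          (add_le_add (hausdorffEDist_natCast_smul_add_le hA hB hAne hBne C n)
            (hausdorffEDist_add_self_le _ C))
    _ = n * hausdorffEDist (A + C) (B + C) + 2 * hausdorffEDist C 0 := by ring

/-- Rådström's cancellation law, in metric form. -/
lemma hausdorffEDist_le_hausdorffEDist_add_right {A B C : Set E} (hA : Convex ℝ A)
    (hB : Convex ℝ B) (hAne : A.Nonempty) (hBne : B.Nonempty) (hC : C.Nonempty)
    (hCb : Bornology.IsBounded C) :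
    hausdorffEDist A B ≤ hausdorffEDist (A + C) (B + C) := by
  set δ := hausdorffEDist (A + C) (B + C)
  set K := hausdorffEDist C 0
  have le_add_inv_mul (n : ℕ) (hn : n ≠ 0) :
      hausdorffEDist A B ≤ δ + (n : ℝ≥0∞)⁻¹ * (2 * K) := by
    have hn' : (n : ℝ) ≠ 0 := Nat.cast_ne_zero.2 hn
    have enorm_inv : ‖(n : ℝ)⁻¹‖ₑ = (n : ℝ≥0∞)⁻¹ := by
      rw [enorm_inv hn', Real.enorm_natCast]
    calc hausdorffEDist A B
        = hausdorffEDist ((n : ℝ)⁻¹ • (n : ℝ) • A) ((n : ℝ)⁻¹ • (n : ℝ) • B) := by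
          rw [inv_smul_smul₀ hn', inv_smul_smul₀ hn']
      _ ≤ (n : ℝ≥0∞)⁻¹ * hausdorffEDist ((n : ℝ) • A) ((n : ℝ) • B) :=
          enorm_inv ▸ hausdorffEDist_smul_le hAne.smul_set hBne.smul_set _
      _ ≤ (n : ℝ≥0∞)⁻¹ * (n * δ + 2 * K) :=
          mul_le_mul_right (hausdorffEDist_natCast_smul_le hA hB hAne hBne C n) _
      _ = δ + (n : ℝ≥0∞)⁻¹ * (2 * K) := by
          rw [mul_add, ← mul_assoc, ENNReal.inv_mul_cancel (by exact_mod_cast hn)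
            (ENNReal.natCast_ne_top n), one_mul]
  have tendsto_add_inv_mul :
      Tendsto (fun n : ℕ => δ + (n : ℝ≥0∞)⁻¹ * (2 * K)) atTop (𝓝 δ) := by
    have hK : 2 * K ≠ ∞ :=
      ENNReal.mul_ne_top ENNReal.ofNat_ne_top (hausdorffEDist_zero_ne_top hC hCb)
    simpa using (ENNReal.Tendsto.mul_const ENNReal.tendsto_inv_nat_nhds_zero
      (Or.inr hK)).const_add δ
  exact ge_of_tendsto tendsto_add_inv_mul ((eventually_ne_atTop 0).mono le_add_inv_mul)

lemma hausdorffEDist_smul_add_smul_self_le {A B : Set E} (hB : Convex ℝ B) (hAne : A.Nonempty)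
    (hBne : B.Nonempty) {a b : ℝ} (ha : 0 ≤ a) (hb : 0 ≤ b) (hab : a + b = 1) :
    hausdorffEDist (a • A + b • A) A ≤ 2 * hausdorffEDist A B :=
  calc hausdorffEDist (a • A + b • A) A
      ≤ hausdorffEDist (a • A + b • A) (a • B + b • B) + hausdorffEDist B A := by
        rw [← hB.add_smul ha hb, hab, one_smul]
        exact hausdorffEDist_triangle
    _ ≤ ‖a‖ₑ * hausdorffEDist A B + ‖b‖ₑ * hausdorffEDist A B + hausdorffEDist A B := by
        rw [hausdorffEDist_comm (s := B)]
        exact add_le_add_left ((hausdorffEDist_add_add_le _ _ _ _).trans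
          (add_le_add (hausdorffEDist_smul_le hAne hBne a) (hausdorffEDist_smul_le hAne hBne b))) _
    _ = 2 * hausdorffEDist A B := by
        rw [← add_mul, Real.enorm_of_nonneg ha, Real.enorm_of_nonneg hb,
          ← ENNReal.ofReal_add ha hb, hab, ENNReal.ofReal_one, one_mul, two_mul]

lemma convex_of_tendsto_hausdorffEDist {ι : Type*} {l : Filter ι} [l.NeBot] {A : Set E}
    {B : ι → Set E} (hA : IsClosed A) (hAne : A.Nonempty) (hB : ∀ i, Convex ℝ (B i))
    (hBne : ∀ i, (B i).Nonempty) (h : Tendsto (fun i => hausdorffEDist A (B i)) l (𝓝 0)) :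
    Convex ℝ A := by
  refine convex_iff_pointwise_add_subset.2 fun a b ha hb hab => ?_
  have hlim : Tendsto (fun i => 2 * hausdorffEDist A (B i)) l (𝓝 0) := by
    simpa using ENNReal.Tendsto.const_mul h (Or.inr ENNReal.ofNat_ne_top)
  have hzero : hausdorffEDist (a • A + b • A) A = 0 := le_zero_iff.1 <| ge_of_tendsto' hlim
    fun i => hausdorffEDist_smul_add_smul_self_le (hB i) hAne (hBne i) ha hb hab
  rw [hausdorffEDist_zero_iff_closure_eq_closure, hA.closure_eq] at hzero
  exact subset_closure.trans hzero.subset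

end HausdorffEDist

namespace ClosedBoundedConvex

variable {X : Type*} [NormedAddCommGroup X] [NormedSpace ℝ X]

/-- `cb(X)` as a family of closed sets; the extended Hausdorff distance on `Closeds X` is complete
when `X` is. -/
def toCloseds (K : ClosedBoundedConvex X) : TopologicalSpace.Closeds X :=
  ⟨K.carrier, K.isClosed'⟩

lemma toCloseds_injective :
    Function.Injective (toCloseds : ClosedBoundedConvex X → TopologicalSpace.Closeds X) := by
  rintro ⟨K, _, _, _, _⟩ ⟨L, _, _, _, _⟩ h
  obtain rfl : K = L := congrArg TopologicalSpace.Closeds.carrier h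
  rfl

noncomputable instance : EMetricSpace (ClosedBoundedConvex X) :=
  EMetricSpace.induced toCloseds toCloseds_injective inferInstance

lemma edist_eq (K L : ClosedBoundedConvex X) : edist K L = hausdorffEDist (K : Set X) L :=
  TopologicalSpace.Closeds.edist_eq

noncomputable instance : MetricSpace (ClosedBoundedConvex X) :=
  EMetricSpace.toMetricSpace fun K L => edist_eq K L ▸
    hausdorffEDist_ne_top_of_nonempty_of_bounded K.nonempty' L.nonempty' K.isBounded' L.isBounded'

lemma dist_eq (K L : ClosedBoundedConvex X) : dist K L = hausdorffDist (K : Set X) L := by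
  rw [dist_edist, edist_eq, hausdorffDist]

lemma isometry_toCloseds :
    Isometry (toCloseds : ClosedBoundedConvex X → TopologicalSpace.Closeds X) :=
  fun _ _ => rfl

lemma isClosed_range_toCloseds :
    IsClosed (Set.range (toCloseds : ClosedBoundedConvex X → TopologicalSpace.Closeds X)) := by
  refine isClosed_of_closure_subset fun K hK => ?_
  obtain ⟨u, hu, hlim⟩ := mem_closure_iff_seq_limit.1 hK
  choose L hL using hu
  obtain rfl : (fun n => toCloseds (L n)) = u := funext hL
  replace hlim : Tendsto (fun n => hausdorffEDist (K : Set X) (L n)) atTop (𝓝 0) :=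
    (tendsto_iff_edist_tendsto_0.1 hlim).congr fun n => hausdorffEDist_comm
  obtain ⟨N, hN⟩ := (hlim.eventually_lt_const one_pos).exists
  have nonempty : (K : Set X).Nonempty :=
    nonempty_of_hausdorffEDist_ne_top (L N).nonempty' (hausdorffEDist_comm.trans_lt hN).ne_top
  have isBounded : Bornology.IsBounded (K : Set X) :=
    (L N).isBounded'.cthickening.subset fun x hx => show _ ≤ ENNReal.ofReal 1 by
      simpa using (infEDist_le_hausdorffEDist_of_mem hx).trans hN.le
  have convex : Convex ℝ (K : Set X) := convex_of_tendsto_hausdorffEDist K.isClosed nonempty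
    (fun n => (L n).convex') (fun n => (L n).nonempty') hlim
  exact ⟨⟨K, nonempty, K.isClosed, isBounded, convex⟩, rfl⟩

instance [CompleteSpace X] : CompleteSpace (ClosedBoundedConvex X) :=
  (completeSpace_iff_isComplete_range isometry_toCloseds.isUniformInducing).2
    isClosed_range_toCloseds.isComplete

end ClosedBoundedConvex

section Partition

variable {Ω : Type*} [MeasurableSpace Ω]

/-- The partition that agrees with `P` on `A` and with `Q` on the complement of `A`. -/
def Partition.glue (P Q : Partition Ω) {A : Set Ω} (hA : MeasurableSet A) : Partition Ω where
  size := P.size + Q.size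
  part := Fin.append (fun i => P.part i ∩ A) (fun j => Q.part j ∩ Aᶜ)
  tag := Fin.append P.tag Q.tag
  measurable' := Fin.addCases
    (fun i => by simpa using (P.measurable' i).inter hA)
    (fun j => by simpa using (Q.measurable' j).inter hA.compl)
  disjoint' := by
    have hd : ∀ s t : Set Ω, Disjoint (s ∩ A) (t ∩ Aᶜ) := fun s t =>
      disjoint_compl_right.mono Set.inter_subset_right Set.inter_subset_right
    intro i j
    refine Fin.addCases (fun i => ?_) (fun i => ?_) i <;>
      refine Fin.addCases (fun j => ?_) (fun j => ?_) j <;> intro hij <;>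
      simp only [Fin.append_left, Fin.append_right]
    · exact (P.disjoint' fun h => hij (by rw [h])).mono Set.inter_subset_left Set.inter_subset_left
    · exact hd _ _
    · exact (hd _ _).symm
    · exact (Q.disjoint' fun h => hij (by rw [h])).mono Set.inter_subset_left Set.inter_subset_left
  cover' := by
    refine Set.eq_univ_of_forall fun x => Set.mem_iUnion.2 ?_
    by_cases hx : x ∈ A
    · obtain ⟨i, hi⟩ := Set.mem_iUnion.1 (P.cover'.symm ▸ Set.mem_univ x)
      exact ⟨Fin.castAdd _ i, by simpa using ⟨hi, hx⟩⟩
    · obtain ⟨j, hj⟩ := Set.mem_iUnion.1 (Q.cover'.symm ▸ Set.mem_univ x)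
      exact ⟨Fin.natAdd _ j, by simpa using ⟨hj, hx⟩⟩

variable [TopologicalSpace Ω]

lemma Partition.Subordinate.glue {P Q : Partition Ω} {Δ : Gauge Ω} (hP : P.Subordinate Δ)
    (hQ : Q.Subordinate Δ) {A : Set Ω} (hA : MeasurableSet A) :
    (P.glue Q hA).Subordinate Δ := by
  intro i
  refine Fin.addCases (fun i => ?_) (fun i => ?_) i
  · simpa [Partition.glue] using Set.inter_subset_left.trans (hP i)
  · simpa [Partition.glue] using Set.inter_subset_left.trans (hQ i)

instance : Nonempty (Gauge Ω) :=
  ⟨⟨fun _ => Set.univ, fun _ => isOpen_univ, fun _ => Set.mem_univ _⟩⟩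

/-- The pointwise intersection of two gauges. -/
def Gauge.inter (Δ Δ' : Gauge Ω) : Gauge Ω where
  toFun t := Δ.toFun t ∩ Δ'.toFun t
  isOpen' t := (Δ.isOpen' t).inter (Δ'.isOpen' t)
  mem' t := ⟨Δ.mem' t, Δ'.mem' t⟩

lemma Gauge.exists_subordinate [CompactSpace Ω] [OpensMeasurableSpace Ω] (Δ : Gauge Ω) :
    ∃ P : Partition Ω, P.Subordinate Δ := by
  obtain ⟨s, hs⟩ := isCompact_univ.elim_finite_subcover Δ.toFun Δ.isOpen'
    (fun t _ => Set.mem_iUnion.2 ⟨t, Δ.mem' t⟩)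
  let tag : Fin s.card → Ω := fun i => s.equivFin.symm i
  refine ⟨⟨s.card, disjointed fun i => Δ.toFun (tag i), tag, fun i => ?_, disjoint_disjointed _,
    ?_⟩, fun i => disjointed_subset (fun i => Δ.toFun (tag i)) i⟩
  · exact disjointedRec (fun _ _ ht => ht.diff (Δ.isOpen' _).measurableSet)
      (Δ.isOpen' _).measurableSet
  · rw [iUnion_disjointed]
    refine Set.eq_univ_of_forall fun x => Set.mem_iUnion.2 ?_
    obtain ⟨t, ht, hx⟩ := Set.mem_iUnion₂.1 (hs (Set.mem_univ x))
    exact ⟨s.equivFin ⟨t, ht⟩, by simpa [tag] using hx⟩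

variable (Ω) in
/-- The filter of partitions generated by the sets of partitions subordinated to a gauge. -/
def partitionFilter : Filter (Partition Ω) := ⨅ Δ : Gauge Ω, 𝓟 {P | P.Subordinate Δ}

lemma hasBasis_partitionFilter :
    (partitionFilter Ω).HasBasis (fun _ : Gauge Ω => True) fun Δ => {P | P.Subordinate Δ} :=
  hasBasis_iInf_principal fun Δ Δ' => ⟨Δ.inter Δ',
    fun _ hP i => (hP i).trans Set.inter_subset_left,
    fun _ hP i => (hP i).trans Set.inter_subset_right⟩

instance [CompactSpace Ω] [OpensMeasurableSpace Ω] : (partitionFilter Ω).NeBot :=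
  hasBasis_partitionFilter.neBot_iff.2 fun _ => Gauge.exists_subordinate _

end Partition

section Sum

variable {Ω X : Type*} [MeasurableSpace Ω] [NormedAddCommGroup X] [NormedSpace ℝ X]

lemma mcShaneSum_nonempty (Γ : Ω → ClosedBoundedConvex X) (μ : Measure Ω) (P : Partition Ω) :
    (mcShaneSum Γ μ P).Nonempty :=
  Finset.sum_induction _ Set.Nonempty (fun _ _ => Set.Nonempty.add) Set.zero_nonempty
    fun i _ => (Γ (P.tag i)).nonempty'.smul_set

lemma isBounded_mcShaneSum (Γ : Ω → ClosedBoundedConvex X) (μ : Measure Ω) (P : Partition Ω) :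
    Bornology.IsBounded (mcShaneSum Γ μ P) :=
  Finset.sum_induction _ Bornology.IsBounded (fun _ _ => Bornology.IsBounded.add)
    Bornology.isBounded_singleton fun i _ => (Γ (P.tag i)).isBounded'.smul₀ _

lemma convex_mcShaneSum (Γ : Ω → ClosedBoundedConvex X) (μ : Measure Ω) (P : Partition Ω) :
    Convex ℝ (mcShaneSum Γ μ P) :=
  convex_sum _ fun i _ => (Γ (P.tag i)).convex'.smul _

/-- The McShane sum as a point of `cb(X)`. A Minkowski sum of closed sets need not be closed;
taking the closure does not change Hausdorff distances. -/
def closedMcShaneSum (Γ : Ω → ClosedBoundedConvex X) (μ : Measure Ω) (P : Partition Ω) :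
    ClosedBoundedConvex X where
  carrier := closure (mcShaneSum Γ μ P)
  nonempty' := (mcShaneSum_nonempty Γ μ P).closure
  isClosed' := isClosed_closure
  isBounded' := (isBounded_mcShaneSum Γ μ P).closure
  convex' := (convex_mcShaneSum Γ μ P).closure

lemma edist_closedMcShaneSum (Γ Γ' : Ω → ClosedBoundedConvex X) (μ ν : Measure Ω)
    (P Q : Partition Ω) :
    edist (closedMcShaneSum Γ μ P) (closedMcShaneSum Γ' ν Q) =
      hausdorffEDist (mcShaneSum Γ μ P) (mcShaneSum Γ' ν Q) :=
  (ClosedBoundedConvex.edist_eq _ _).trans hausdorffEDist_closure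

lemma dist_closedMcShaneSum_right (I : ClosedBoundedConvex X) (Γ : Ω → ClosedBoundedConvex X)
    (μ : Measure Ω) (P : Partition Ω) :
    dist I (closedMcShaneSum Γ μ P) = hausdorffDist (I : Set X) (mcShaneSum Γ μ P) :=
  (ClosedBoundedConvex.dist_eq _ _).trans hausdorffDist_closure₂

lemma mcShaneSum_glue (Γ : Ω → ClosedBoundedConvex X) (μ : Measure Ω)
    (P Q : Partition Ω) {A : Set Ω} (hA : MeasurableSet A) :
    mcShaneSum Γ μ (P.glue Q hA) =
      mcShaneSum Γ (μ.restrict A) P + mcShaneSum Γ (μ.restrict Aᶜ) Q := by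
  simp only [mcShaneSum, measureReal_restrict_apply (P.measurable' _),
    measureReal_restrict_apply (Q.measurable' _)]
  change ∑ i : Fin (P.size + Q.size), _ = _
  rw [Fin.sum_univ_add]
  simp [Partition.glue]

/-- Gluing the same `P` outside `A` adds a common Minkowski summand, which cancels. -/
lemma edist_closedMcShaneSum_restrict_le (Γ : Ω → ClosedBoundedConvex X) (μ : Measure Ω)
    (P Q : Partition Ω) {A : Set Ω} (hA : MeasurableSet A) :
    edist (closedMcShaneSum Γ (μ.restrict A) P) (closedMcShaneSum Γ (μ.restrict A) Q) ≤
      edist (closedMcShaneSum Γ μ (P.glue P hA)) (closedMcShaneSum Γ μ (Q.glue P hA)) := by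
  simp only [edist_closedMcShaneSum, mcShaneSum_glue]
  exact hausdorffEDist_le_hausdorffEDist_add_right (convex_mcShaneSum Γ _ P)
    (convex_mcShaneSum Γ _ Q) (mcShaneSum_nonempty Γ _ P) (mcShaneSum_nonempty Γ _ Q)
    (mcShaneSum_nonempty Γ _ P) (isBounded_mcShaneSum Γ _ P)

lemma edist_closedMcShaneSum_le (Γ Γ' : Ω → ClosedBoundedConvex X) (μ ν : Measure Ω)
    (P : Partition Ω) :
    edist (closedMcShaneSum Γ μ P) (closedMcShaneSum Γ' ν P) ≤
      ∑ i, (‖μ.real (P.part i)‖ₑ * edist (Γ (P.tag i)) (Γ' (P.tag i)) +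
        ‖μ.real (P.part i) - ν.real (P.part i)‖ₑ *
          hausdorffEDist (Γ' (P.tag i) : Set X) 0) := by
  rw [edist_closedMcShaneSum]
  refine (hausdorffEDist_finsetSum_le _ _ _).trans (Finset.sum_le_sum fun i _ => ?_)
  rw [ClosedBoundedConvex.edist_eq]
  exact hausdorffEDist_smul_smul_le (Γ _).nonempty' (Γ' _).nonempty' _ _

end Sum

section InterchangeOfLimits

variable {ι κ α Y : Type*} [UniformSpace Y] {F : ι → κ → α → Y} {f : κ → α → Y}
  {p : Filter κ} {l : Filter ι} {s : Set α}

lemma uniformCauchySeqOn_of_tendsto [l.NeBot]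
    (hF : UniformCauchySeqOn (fun k (x : ι × α) => F x.1 k x.2) p (Set.univ ×ˢ s))
    (hf : ∀ k, ∀ a ∈ s, Tendsto (fun i => F i k a) l (𝓝 (f k a))) :
    UniformCauchySeqOn f p s := by
  intro u hu
  obtain ⟨v, hv, hvc, hvu⟩ := mem_uniformity_isClosed hu
  filter_upwards [hF v hv] with k hk a ha
  exact hvu <| hvc.mem_of_tendsto ((hf k.1 a ha).prodMk_nhds (hf k.2 a ha))
    (Eventually.of_forall fun i => hk (i, a) ⟨trivial, ha⟩)

/-- The Moore–Osgood theorem, uniformly in a parameter ranging over `s`. -/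
lemma tendstoUniformlyOn_of_tendstoUniformlyOn_prod [p.NeBot] {I : ι → α → Y} {J : α → Y}
    (hF : TendstoUniformlyOn (fun k (x : ι × α) => F x.1 k x.2) (fun x => I x.1 x.2) p
      (Set.univ ×ˢ s))
    (hf : ∀ k, TendstoUniformlyOn (fun i => F i k) (f k) l s) (hJ : TendstoUniformlyOn f J p s) :
    TendstoUniformlyOn I J l s := by
  intro u hu
  obtain ⟨v, hv, hsymm, hvu⟩ := comp_comp_symm_mem_uniformity_sets hu
  obtain ⟨k, hFk, hJk⟩ := ((hF v hv).and (hJ v hv)).exists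
  filter_upwards [hf k v hv] with i hi a ha
  exact hvu ⟨F i k a, ⟨f k a, hJk a ha, hi a ha⟩, hsymm.symm _ _ (hFk (i, a) ⟨trivial, ha⟩)⟩

end InterchangeOfLimits

section Integral

variable {ι Ω X : Type*} [TopologicalSpace Ω] [MeasurableSpace Ω]
  [NormedAddCommGroup X] [NormedSpace ℝ X]

lemma hasMcShaneIntegral_iff_tendsto {Γ : Ω → ClosedBoundedConvex X} {μ : Measure Ω}
    {I : ClosedBoundedConvex X} :
    HasMcShaneIntegral Γ μ I ↔
      Tendsto (closedMcShaneSum Γ μ) (partitionFilter Ω) (𝓝 I) := by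
  simp only [hasBasis_partitionFilter.tendsto_iff Metric.nhds_basis_ball, HasMcShaneIntegral,
    true_and, mem_ball', Set.mem_ofPred_eq, dist_closedMcShaneSum_right]

lemma McShaneIntegrable.tendsto_mcShaneIntegral {Γ : Ω → ClosedBoundedConvex X} {μ : Measure Ω}
    (h : McShaneIntegrable Γ μ) :
    Tendsto (closedMcShaneSum Γ μ) (partitionFilter Ω) (𝓝 (mcShaneIntegral Γ μ)) := by
  rw [mcShaneIntegral, dif_pos h]
  exact hasMcShaneIntegral_iff_tendsto.1 h.choose_spec

lemma EquiIntegrable.tendstoUniformlyOn {Γ : ℕ → Ω → ClosedBoundedConvex X} {μ : ℕ → Measure Ω}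
    (h : EquiIntegrable Γ μ) :
    TendstoUniformlyOn (fun P n => closedMcShaneSum (Γ n) (μ n) P)
      (fun n => mcShaneIntegral (Γ n) (μ n)) (partitionFilter Ω) Set.univ := by
  refine Metric.tendstoUniformlyOn_iff.2 fun ε hε => ?_
  obtain ⟨Δ, hΔ⟩ := h.2 ε hε
  refine hasBasis_partitionFilter.eventually_iff.2 ⟨Δ, trivial, fun P hP n _ => ?_⟩
  rw [dist_closedMcShaneSum_right, hausdorffDist_comm]
  exact hΔ n P hP

variable {Γ : ι → Ω → ClosedBoundedConvex X} {μ : ι → Measure Ω}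

lemma uniformCauchySeqOn_closedMcShaneSum_restrict {s : Set ι}
    (h : UniformCauchySeqOn (fun P i => closedMcShaneSum (Γ i) (μ i) P) (partitionFilter Ω) s) :
    UniformCauchySeqOn
      (fun P (x : ι × Set Ω) => closedMcShaneSum (Γ x.1) ((μ x.1).restrict x.2) P)
      (partitionFilter Ω) (s ×ˢ {A | MeasurableSet A}) := by
  intro u hu
  obtain ⟨ε, hε, hεu⟩ := mem_uniformity_edist.1 hu
  obtain ⟨Δ, -, hΔ⟩ := hasBasis_partitionFilter.prod_self.eventually_iff.1
    (h _ (edist_mem_uniformity hε))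
  refine hasBasis_partitionFilter.prod_self.eventually_iff.2 ⟨Δ, trivial, ?_⟩
  rintro ⟨P, Q⟩ ⟨hP, hQ⟩ ⟨i, A⟩ ⟨hi, hA⟩
  exact hεu ((edist_closedMcShaneSum_restrict_le (Γ i) (μ i) P Q hA).trans_lt
    (hΔ (x := (P.glue P hA, Q.glue P hA)) ⟨hP.glue hP hA, hQ.glue hP hA⟩ i hi))

variable [CompactSpace Ω] [OpensMeasurableSpace Ω] [CompleteSpace X]

lemma mcShaneIntegrable_of_uniformCauchySeqOn {s : Set ι}
    (h : UniformCauchySeqOn (fun P i => closedMcShaneSum (Γ i) (μ i) P) (partitionFilter Ω) s)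
    {i : ι} (hi : i ∈ s) : McShaneIntegrable (Γ i) (μ i) :=
  (cauchy_map_iff_exists_tendsto.1 (h.cauchy_map hi)).imp fun _ => hasMcShaneIntegral_iff_tendsto.2

lemma tendstoUniformlyOn_mcShaneIntegral {s : Set ι}
    (h : UniformCauchySeqOn (fun P i => closedMcShaneSum (Γ i) (μ i) P) (partitionFilter Ω) s) :
    TendstoUniformlyOn (fun P i => closedMcShaneSum (Γ i) (μ i) P)
      (fun i => mcShaneIntegral (Γ i) (μ i)) (partitionFilter Ω) s :=
  h.tendstoUniformlyOn_of_tendsto fun _ hi =>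
    (mcShaneIntegrable_of_uniformCauchySeqOn h hi).tendsto_mcShaneIntegral

end Integral

section ConvergenceOfMeasures

variable {ι Ω : Type*} [MeasurableSpace Ω]

/-- The measures `ms i` converge to `m` on the traces `B ∩ A` of every measurable set `B`, uniformly
in `A ∈ 𝒜`. Setwise convergence is the case of a single `A`, and convergence in total variation
gives the case of all measurable `A`. -/
def TendstoUniformlyOnTraces (ms : ι → Measure Ω) (m : Measure Ω) (l : Filter ι)
    (𝒜 : Set (Set Ω)) : Prop :=
  ∀ B, MeasurableSet B →
    TendstoUniformlyOn (fun i A => (ms i).real (B ∩ A)) (fun A => m.real (B ∩ A)) l 𝒜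

lemma TendstoUniformlyOnTraces.tendsto_enorm_sub {ms : ι → Measure Ω} {m : Measure Ω}
    {l : Filter ι} {𝒜 : Set (Set Ω)} (h : TendstoUniformlyOnTraces ms m l 𝒜) {B : Set Ω}
    (hB : MeasurableSet B) :
    Tendsto (fun x : ι × Set Ω => ‖m.real (B ∩ x.2) - (ms x.1).real (B ∩ x.2)‖ₑ)
      (l ×ˢ 𝓟 𝒜) (𝓝 0) := by
  have hdist := tendsto_uniformity_iff_dist_tendsto_zero.1
    (tendstoUniformlyOn_iff_tendsto.1 (h B hB))
  simpa only [← edist_dist, edist_eq_enorm_sub, ENNReal.ofReal_zero] using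
    ENNReal.tendsto_ofReal hdist

variable {ms : ℕ → Measure Ω} {m : Measure Ω}

lemma SetwiseTendsto.tendstoUniformlyOnTraces (h : SetwiseTendsto ms m) {A : Set Ω}
    (hA : MeasurableSet A) : TendstoUniformlyOnTraces ms m atTop {A} := fun B hB =>
  tendstoUniformlyOn_singleton_iff_tendsto.2 (h (B ∩ A) (hB.inter hA))

lemma TotalVariationTendsto.tendstoUniformlyOnTraces [∀ n, IsFiniteMeasure (ms n)]
    [IsFiniteMeasure m] (h : TotalVariationTendsto ms m) :
    TendstoUniformlyOnTraces ms m atTop {A | MeasurableSet A} := by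
  intro B hB
  refine Metric.tendstoUniformlyOn_iff.2 fun ε hε => ?_
  have hreal := (ENNReal.tendsto_toReal ENNReal.zero_ne_top).comp h
  filter_upwards [hreal.eventually_lt_const hε] with n hn A hA
  have hsub := (m.toSignedMeasure - (ms n).toSignedMeasure).norm_le_totalVariation (B ∩ A)
  rw [Measure.toSignedMeasure_sub_apply (hB.inter hA), ← dist_eq_norm] at hsub
  exact (hsub.trans (measureReal_mono (Set.subset_univ _))).trans_lt hn

end ConvergenceOfMeasures

section LimitTheorem

variable {ι Ω X : Type*} [MeasurableSpace Ω] [NormedAddCommGroup X] [NormedSpace ℝ X]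
  {Γ : Ω → ClosedBoundedConvex X} {Γs : ι → Ω → ClosedBoundedConvex X} {m : Measure Ω}
  [IsFiniteMeasure m] {ms : ι → Measure Ω} {l : Filter ι} {𝒜 : Set (Set Ω)}

lemma tendstoUniformlyOn_closedMcShaneSum_restrict
    (hΓ : ∀ t, Tendsto (fun i => Γs i t) l (𝓝 (Γ t))) (hm : TendstoUniformlyOnTraces ms m l 𝒜)
    (P : Partition Ω) :
    TendstoUniformlyOn (fun i A => closedMcShaneSum (Γs i) ((ms i).restrict A) P)
      (fun A => closedMcShaneSum Γ (m.restrict A) P) l 𝒜 := by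
  have tendsto_edist (t : Ω) : Tendsto (fun i => edist (Γ t) (Γs i t)) l (𝓝 0) := by
    simpa only [edist_self] using (tendsto_const_nhds (x := Γ t)).edist (hΓ t)
  have tendsto_hausdorffEDist_zero (t : Ω) :
      Tendsto (fun i => hausdorffEDist (Γs i t : Set X) 0) l (𝓝 (hausdorffEDist (Γ t : Set X) 0)) :=
    -- `default : ClosedBoundedConvex X` is `{0}`
    (hΓ t).edist (tendsto_const_nhds (x := default))
  have tendsto_bound : Tendsto (fun x : ι × Set Ω =>
      ∑ j, (m Set.univ * edist (Γ (P.tag j)) (Γs x.1 (P.tag j)) +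
        ‖m.real (P.part j ∩ x.2) - (ms x.1).real (P.part j ∩ x.2)‖ₑ *
          hausdorffEDist (Γs x.1 (P.tag j) : Set X) 0)) (l ×ˢ 𝓟 𝒜) (𝓝 0) := by
    have tendsto_summand (j : Fin P.size) :=
      (ENNReal.Tendsto.const_mul ((tendsto_edist (P.tag j)).comp (tendsto_fst (g := 𝓟 𝒜)))
        (Or.inr (measure_ne_top m Set.univ))).add
      (ENNReal.Tendsto.mul (hm.tendsto_enorm_sub (P.measurable' j))
        (Or.inr (hausdorffEDist_zero_ne_top (Γ _).nonempty' (Γ _).isBounded'))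
        ((tendsto_hausdorffEDist_zero (P.tag j)).comp tendsto_fst) (Or.inr ENNReal.zero_ne_top))
    simpa using tendsto_finsetSum Finset.univ fun j _ => tendsto_summand j
  refine EMetric.tendstoUniformlyOn_iff.2 fun ε hε => ?_
  filter_upwards [eventually_prod_principal_iff.1 (tendsto_bound.eventually_lt_const hε)]
    with i hi A hA
  refine ((edist_closedMcShaneSum_le _ _ _ _ P).trans (Finset.sum_le_sum fun j _ => ?_)).trans_lt
    (hi A hA)
  have enorm_le : ‖m.real (P.part j ∩ A)‖ₑ ≤ m Set.univ := by
    rw [Real.enorm_of_nonneg measureReal_nonneg, ofReal_measureReal]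
    exact measure_mono (Set.subset_univ _)
  simp only [measureReal_restrict_apply (P.measurable' j)]
  gcongr

variable [TopologicalSpace Ω] [l.NeBot]

lemma uniformCauchySeqOn_closedMcShaneSum_limit
    (hΓs : UniformCauchySeqOn (fun P i => closedMcShaneSum (Γs i) (ms i) P) (partitionFilter Ω)
      Set.univ)
    (hΓ : ∀ t, Tendsto (fun i => Γs i t) l (𝓝 (Γ t))) (hm : TendstoUniformlyOnTraces ms m l 𝒜)
    (h𝒜 : 𝒜 ⊆ {A | MeasurableSet A}) :
    UniformCauchySeqOn (fun P A => closedMcShaneSum Γ (m.restrict A) P) (partitionFilter Ω) 𝒜 :=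
  uniformCauchySeqOn_of_tendsto
    ((uniformCauchySeqOn_closedMcShaneSum_restrict hΓs).mono (Set.prod_mono_right h𝒜))
    fun P _ => (tendstoUniformlyOn_closedMcShaneSum_restrict hΓ hm P).tendsto_at

variable [CompactSpace Ω] [OpensMeasurableSpace Ω] [CompleteSpace X]

theorem mcShaneIntegrableOn_limit
    (hΓs : UniformCauchySeqOn (fun P i => closedMcShaneSum (Γs i) (ms i) P) (partitionFilter Ω)
      Set.univ)
    (hΓ : ∀ t, Tendsto (fun i => Γs i t) l (𝓝 (Γ t))) (hm : TendstoUniformlyOnTraces ms m l 𝒜)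
    (h𝒜 : 𝒜 ⊆ {A | MeasurableSet A}) {A : Set Ω} (hA : A ∈ 𝒜) : McShaneIntegrableOn Γ A m :=
  mcShaneIntegrable_of_uniformCauchySeqOn (Γ := fun _ => Γ) (μ := fun A => m.restrict A)
    (uniformCauchySeqOn_closedMcShaneSum_limit hΓs hΓ hm h𝒜) hA

theorem tendstoUniformlyOn_mcShaneIntegralOn
    (hΓs : UniformCauchySeqOn (fun P i => closedMcShaneSum (Γs i) (ms i) P) (partitionFilter Ω)
      Set.univ)
    (hΓ : ∀ t, Tendsto (fun i => Γs i t) l (𝓝 (Γ t))) (hm : TendstoUniformlyOnTraces ms m l 𝒜)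
    (h𝒜 : 𝒜 ⊆ {A | MeasurableSet A}) :
    TendstoUniformlyOn (fun i A => mcShaneIntegralOn (Γs i) A (ms i))
      (fun A => mcShaneIntegralOn Γ A m) l 𝒜 :=
  tendstoUniformlyOn_of_tendstoUniformlyOn_prod
    ((tendstoUniformlyOn_mcShaneIntegral
      (uniformCauchySeqOn_closedMcShaneSum_restrict hΓs)).mono (Set.prod_mono_right h𝒜))
    (tendstoUniformlyOn_closedMcShaneSum_restrict hΓ hm)
    (tendstoUniformlyOn_mcShaneIntegral (Γ := fun _ => Γ) (μ := fun A => m.restrict A)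
      (uniformCauchySeqOn_closedMcShaneSum_limit hΓs hΓ hm h𝒜))

end LimitTheorem

end McShane

theorem theorem3p13 {Ω X : Type*} [TopologicalSpace Ω] [CompactSpace Ω]
    [MeasurableSpace Ω] [OpensMeasurableSpace Ω]
    [NormedAddCommGroup X] [NormedSpace ℝ X] [CompleteSpace X]
    (m : Measure Ω) [IsFiniteMeasure m]
    (ms : ℕ → Measure Ω) [∀ n, IsFiniteMeasure (ms n)]
    (Γ : Ω → McShane.ClosedBoundedConvex X) (Γs : ℕ → Ω → McShane.ClosedBoundedConvex X)
    (hint : ∀ n, McShane.McShaneIntegrable (Γs n) (ms n))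
    (hequi : McShane.EquiIntegrable Γs ms)
    (hlim : ∀ t : Ω,
      Tendsto (fun n => Metric.hausdorffDist (Γs n t : Set X) (Γ t : Set X)) atTop (𝓝 0)) :
    (McShane.SetwiseTendsto ms m →
      McShane.McShaneIntegrable Γ m ∧
      ∀ A : Set Ω, MeasurableSet A →
        (∀ n, McShane.McShaneIntegrableOn (Γs n) A (ms n)) ∧
        McShane.McShaneIntegrableOn Γ A m ∧
        Tendsto (fun n => Metric.hausdorffDist
          (McShane.mcShaneIntegralOn (Γs n) A (ms n) : Set X)
          (McShane.mcShaneIntegralOn Γ A m : Set X)) atTop (𝓝 0)) ∧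
    (McShane.TotalVariationTendsto ms m →
      McShane.McShaneIntegrable Γ m ∧
      (∀ A : Set Ω, MeasurableSet A →
        (∀ n, McShane.McShaneIntegrableOn (Γs n) A (ms n)) ∧
        McShane.McShaneIntegrableOn Γ A m) ∧
      ∀ ε : ℝ, 0 < ε → ∃ N : ℕ, ∀ n, N ≤ n → ∀ A : Set Ω, MeasurableSet A →
        Metric.hausdorffDist
          (McShane.mcShaneIntegralOn (Γs n) A (ms n) : Set X)
          (McShane.mcShaneIntegralOn Γ A m : Set X) < ε) := by
  open McShane in
  have hcauchy := hequi.tendstoUniformlyOn.uniformCauchySeqOn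
  have hΓ (t : Ω) : Tendsto (fun n => Γs n t) atTop (𝓝 (Γ t)) :=
    tendsto_iff_dist_tendsto_zero.2 (hlim t)
  have hΓs (A : Set Ω) (hA : MeasurableSet A) (n : ℕ) : McShaneIntegrableOn (Γs n) A (ms n) :=
    mcShaneIntegrable_of_uniformCauchySeqOn (uniformCauchySeqOn_closedMcShaneSum_restrict hcauchy)
      (i := (n, A)) ⟨trivial, hA⟩
  have integrable_of_univ (h : McShaneIntegrableOn Γ Set.univ m) : McShaneIntegrable Γ m :=
    m.restrict_univ ▸ h
  refine ⟨fun hm => ?_, fun hm => ?_⟩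
  · have hmA {A : Set Ω} (hA : MeasurableSet A) := hm.tendstoUniformlyOnTraces hA
    have hΓA (A : Set Ω) (hA : MeasurableSet A) : McShaneIntegrableOn Γ A m :=
      mcShaneIntegrableOn_limit hcauchy hΓ (hmA hA) (Set.singleton_subset_iff.2 hA) rfl
    refine ⟨integrable_of_univ (hΓA _ .univ), fun A hA => ⟨hΓs A hA, hΓA A hA, ?_⟩⟩
    exact tendsto_iff_dist_tendsto_zero.1 <| tendstoUniformlyOn_singleton_iff_tendsto.1 <|
      tendstoUniformlyOn_mcShaneIntegralOn hcauchy hΓ (hmA hA) (Set.singleton_subset_iff.2 hA)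
  · have hΓA (A : Set Ω) (hA : MeasurableSet A) : McShaneIntegrableOn Γ A m :=
      mcShaneIntegrableOn_limit hcauchy hΓ hm.tendstoUniformlyOnTraces subset_rfl hA
    refine ⟨integrable_of_univ (hΓA _ .univ), fun A hA => ⟨hΓs A hA, hΓA A hA⟩, fun ε hε => ?_⟩
    obtain ⟨N, hN⟩ := eventually_atTop.1 <| Metric.tendstoUniformlyOn_iff.1
      (tendstoUniformlyOn_mcShaneIntegralOn hcauchy hΓ hm.tendstoUniformlyOnTraces subset_rfl) ε hε
    exact ⟨N, fun n hn A hA => (dist_comm _ _).trans_lt (hN n hn A hA)⟩
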